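/- Let $\varphi_0(z)=e^z$ and $\varphi_j(z)=\int_0^1 e^{(1-s)z}\frac{s^{j-1}}{(j-1)!}\,ds$ for $j\ge1$. The three-stage explicit exponential Runge–Kutta method EERK3-2 with abscissas $c_2=\tfrac34$, $c_3=\tfrac35$ has, with $\gamma=\frac{(3c_3-2)c_3}{(2-3c_2)c_2}=\tfrac{16}{25}$, the coefficients $$a_{21}(z)=c_2\varphi_1(c_2z),\quad a_{32}(z)=\gamma c_2\varphi_2(c_2z)+\tfrac{c_3^2}{c_2}\varphi_2(c_3z),\quad a_{31}(z)=c_3\varphi_1(c_3z)-a_{32}(z),$$ $$a_{42}(z)=\tfrac{\gamma}{\gamma c_2+c_3}\varphi_2(z),\quad a_{43}(z)=\tfrac{1}{\gamma c_2+c_3}\varphi_2(z),\quad a_{41}(z)=\varphi_1(z)-a_{42}(z)-a_{43}(z).$$ Put $\underline a_{i+1,i}=a_{i+1,i}$ and $\underline a_{i+1,j}=a_{i+1,j}-a_{i,j}$ for $1\le j<i\le 3$; define $\theta_{k,k}=1/\underline a_{k+1,k}$ and $\theta_{k,j}=-\sum_{\ell=j+1}^{k}\theta_{k,\ell}\,\underline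 a_{\ell+1,j}/\underline a_{j+1,j}$ for $1\le j<k\le 3$; and let $D(z)=(d_{k\ell}(z))_{1\le k,\ell\le3}$ be the lower triangular matrix with $d_{k\ell}(z)=\theta_{k,\ell}(z)+\frac z2(2-\delta_{k\ell})$ for $\ell\le k$. Let $L_h\in\mathbb R^{M\times M}$ be symmetric positive definite, let $\langle u,v\rangle=v^Tu$, let $G_h:\mathbb R^M\to\mathbb R^M$ be such that the functional $v\mapsto\langle G_h(v),1\rangle$ is non-negative and differentiable with gradient $-g_h$, where $g_h:\mathbb R^M\to\mathbb R^M$ is Lipschitz continuous with constant $\ell_g>0$, and set $E[v]=\frac12\langle v,L_hv\rangle+\langle G_h(v),1\rangle$. Let $\kappa\ge2\ell_g$, $L_\kappa=L_h+\kappa I$, $g_\kappa(v)=g_h(v)+\kappa v$. From an arbitrary $u_h^0\in\mathbb R^M$ and with arbitrary step sizes $\tau=\tau_n>0$ (which may depend on $n$), let the method produce, for $n\ge1$, $U^{n,1}=u_h^{n-1}$, $$U^{n,i+1}=U^{n,1}+\sum_{j=1}^{i}a_{i+1,j}(-\tau L_\kappa)\bigl[\tau g_\kappa(U^{n,j})-\tau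 L_\kappa U^{n,1}\bigr]\quad(1\le i\le3),\qquad u_h^n=U^{n,4},$$ and write $\delta_\tau U^{n,i+1}=U^{n,i+1}-U^{n,i}$. (Functions of the symmetric matrix $-\tau L_\kappa$ are defined on its spectrum.) Then: 1. the symmetric part $\frac12\bigl(D(z)+D(z)^T\bigr)$ is positive definite for every $z<0$; 2. the energy dissipation law is preserved unconditionally (without restriction on the step sizes) at all stages: for every $n\ge1$ and $1\le j\le3$, $$E[U^{n,j+1}]-E[U^{n,1}]\le-\frac1{\tau}\sum_{k=1}^{j}\Bigl\langle\delta_\tau U^{n,k+1},\sum_{\ell=1}^{k}d_{k\ell}(-\tau L_\kappa)\,\delta_\tau U^{n,\ell+1}\Bigr\rangle\le0 .$$ -/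

import Mathlib

open scoped NNReal

noncomputable section

namespace EERK

/-! ### The exponential functions and the Butcher tableau of the two-parameter method -/

/-- The functions `φ₀(z) = exp z` and `φⱼ(z) = ∫₀¹ exp((1-s)z) s^(j-1)/(j-1)! ds` for `j ≥ 1`. -/
def phi : ℕ → ℝ → ℝ
  | 0, z => Real.exp z
  | j + 1, z => ∫ s in (0 : ℝ)..1, Real.exp ((1 - s) * z) * (s ^ j / (j.factorial : ℝ))

/-- The parameter `γ = (3c₃ - 2)c₃ / ((2 - 3c₂)c₂)` of the two-parameter family. -/
def gamma (c₂ c₃ : ℝ) : ℝ := ((3 * c₃ - 2) * c₃) / ((2 - 3 * c₂) * c₂)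

/-- The coefficient functions `a i j` (indices counted from `1`) of the three-stage method
EERK3-2 with abscissas `c₂`, `c₃`; the row `i = 4` holds the weights. -/
def coeff32 (c₂ c₃ : ℝ) : ℕ → ℕ → ℝ → ℝ
  | 2, 1, z => c₂ * phi 1 (c₂ * z)
  | 3, 1, z => c₃ * phi 1 (c₃ * z) -
      (gamma c₂ c₃ * c₂ * phi 2 (c₂ * z) + c₃ ^ 2 / c₂ * phi 2 (c₃ * z))
  | 3, 2, z => gamma c₂ c₃ * c₂ * phi 2 (c₂ * z) + c₃ ^ 2 / c₂ * phi 2 (c₃ * z)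
  | 4, 1, z => phi 1 z - gamma c₂ c₃ / (gamma c₂ c₃ * c₂ + c₃) * phi 2 z -
      1 / (gamma c₂ c₃ * c₂ + c₃) * phi 2 z
  | 4, 2, z => gamma c₂ c₃ / (gamma c₂ c₃ * c₂ + c₃) * phi 2 z
  | 4, 3, z => 1 / (gamma c₂ c₃ * c₂ + c₃) * phi 2 z
  | _, _, _ => 0

/-! ### Difference coefficients, DOC kernels and the differentiation matrix -/

/-- The difference coefficients: `diffCoeff a (i+1) i = a (i+1) i` and
`diffCoeff a (i+1) j = a (i+1) j - a i j` for `j < i`. -/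
def diffCoeff (a : ℕ → ℕ → ℝ → ℝ) : ℕ → ℕ → ℝ → ℝ
  | 0, _, _ => 0
  | i + 1, j, z => if j = i then a (i + 1) i z else if j < i then a (i + 1) j z - a i j z else 0

/-- The discrete orthogonal convolution kernels `θ k j` of a lower triangular array `b`:
`θ k k = 1 / b (k+1) k` and
`θ k j = - ∑_{ℓ=j+1}^{k} θ k ℓ * b (ℓ+1) j / b (j+1) j` for `j < k`. -/
def docKernel (b : ℕ → ℕ → ℝ) (k j : ℕ) : ℝ :=
  if j = k then 1 / b (k + 1) k
  else -∑ l ∈ (Finset.Icc (j + 1) k).attach,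
    docKernel b k l.1 * (b (l.1 + 1) j / b (j + 1) j)
termination_by k - j
decreasing_by
  have h := Finset.mem_Icc.mp l.2
  omega

theorem docKernel_self (b : ℕ → ℕ → ℝ) (k : ℕ) : docKernel b k k = 1 / b (k + 1) k := by
  rw [docKernel, if_pos rfl]

theorem docKernel_of_lt (b : ℕ → ℕ → ℝ) {k j : ℕ} (h : j < k) :
    docKernel b k j =
      -∑ l ∈ Finset.Icc (j + 1) k, docKernel b k l * (b (l + 1) j / b (j + 1) j) := by
  rw [docKernel, if_neg h.ne]
  congr 1
  exact Finset.sum_attach (Finset.Icc (j + 1) k)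
    (fun l => docKernel b k l * (b (l + 1) j / b (j + 1) j))

/-- The entries `d k ℓ` (indices counted from `1`) of the differentiation matrix of the method
with coefficients `a`: `d k ℓ = θ k ℓ + (z/2)(2 - δ k ℓ)` for `ℓ ≤ k`, and `0` for `ℓ > k`,
where the `θ` are the DOC kernels of the difference coefficients. -/
def diffEntry (a : ℕ → ℕ → ℝ → ℝ) (k l : ℕ) (z : ℝ) : ℝ :=
  if l ≤ k then
    docKernel (fun i j => diffCoeff a i j z) k l + z / 2 * (2 - if k = l then 1 else 0)
  else 0

/-- The `s × s` differentiation matrix `D(z)`. -/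
def diffMatrix (a : ℕ → ℕ → ℝ → ℝ) (s : ℕ) (z : ℝ) : Matrix (Fin s) (Fin s) ℝ :=
  Matrix.of fun k l => diffEntry a (k.val + 1) (l.val + 1) z

/-- The symmetric part `(D + Dᵀ)/2` of a matrix. -/
def symPart {s : ℕ} (D : Matrix (Fin s) (Fin s) ℝ) : Matrix (Fin s) (Fin s) ℝ :=
  (1 / 2 : ℝ) • (D + D.transpose)

/-! ### The discrete gradient system and the method -/

/-- The action of the matrix function `f(A)` on a vector, for a real symmetric matrix `A`;
`f(A)` is given by the functional calculus, that is, `f` is applied to the eigenvalues. -/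
def matFun {M : ℕ} (f : ℝ → ℝ) (A : Matrix (Fin M) (Fin M) ℝ) (v : EuclideanSpace ℝ (Fin M)) :
    EuclideanSpace ℝ (Fin M) :=
  Matrix.toEuclideanLin (cfc f A) v

/-- The functional `⟨G(v), 1⟩`. -/
def potential {M : ℕ} (G : EuclideanSpace ℝ (Fin M) → EuclideanSpace ℝ (Fin M))
    (v : EuclideanSpace ℝ (Fin M)) : ℝ :=
  ∑ i, G v i

/-- The original energy `E[v] = ½⟨v, L v⟩ + ⟨G(v), 1⟩`. -/
def energy {M : ℕ} (L : Matrix (Fin M) (Fin M) ℝ)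
    (G : EuclideanSpace ℝ (Fin M) → EuclideanSpace ℝ (Fin M))
    (v : EuclideanSpace ℝ (Fin M)) : ℝ :=
  1 / 2 * inner ℝ v (Matrix.toEuclideanLin L v) + potential G v

/-- The stabilized operator `L_κ = L + κ I`. -/
def stabL {M : ℕ} (κ : ℝ) (L : Matrix (Fin M) (Fin M) ℝ) : Matrix (Fin M) (Fin M) ℝ :=
  L + κ • (1 : Matrix (Fin M) (Fin M) ℝ)

/-- The stabilized nonlinearity `g_κ(v) = g(v) + κ v`. -/
def stabG {M : ℕ} (κ : ℝ) (g : EuclideanSpace ℝ (Fin M) → EuclideanSpace ℝ (Fin M))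
    (v : EuclideanSpace ℝ (Fin M)) : EuclideanSpace ℝ (Fin M) :=
  g v + κ • v

/-- `u n` are the numerical solutions, and `U n 1, …, U n (s+1)` the stages of the step from
`u (n-1)` to `u n` with step size `τ n`, produced by the `s`-stage explicit exponential
Runge-Kutta method with coefficients `a` for the system `u' = -L u + g(u)`. -/
structure IsSolution {M : ℕ} (s : ℕ) (a : ℕ → ℕ → ℝ → ℝ) (L : Matrix (Fin M) (Fin M) ℝ)
    (g : EuclideanSpace ℝ (Fin M) → EuclideanSpace ℝ (Fin M)) (τ : ℕ → ℝ)
    (u : ℕ → EuclideanSpace ℝ (Fin M)) (U : ℕ → ℕ → EuclideanSpace ℝ (Fin M)) : Prop where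
  first : ∀ n, 1 ≤ n → U n 1 = u (n - 1)
  stage : ∀ n, 1 ≤ n → ∀ i, 1 ≤ i → i ≤ s →
    U n (i + 1) = U n 1 + ∑ j ∈ Finset.Icc 1 i, matFun (a (i + 1) j) (-(τ n • L))
      (τ n • g (U n j) - τ n • Matrix.toEuclideanLin L (U n 1))
  last : ∀ n, 1 ≤ n → u n = U n (s + 1)

/-- The stage difference `δU^{n,i} = U^{n,i} - U^{n,i-1}` (used for `i ≥ 2`). -/
def stageDiff {M : ℕ} (U : ℕ → ℕ → EuclideanSpace ℝ (Fin M)) (n i : ℕ) :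
    EuclideanSpace ℝ (Fin M) :=
  U n i - U n (i - 1)

/-- The quadratic form
`∑_{k=1}^{j} ⟨δU^{n,k+1}, ∑_{ℓ=1}^{k} d k ℓ(A) δU^{n,ℓ+1}⟩` of the differentiation matrix. -/
def dissipation {M : ℕ} (a : ℕ → ℕ → ℝ → ℝ) (A : Matrix (Fin M) (Fin M) ℝ)
    (U : ℕ → ℕ → EuclideanSpace ℝ (Fin M)) (n j : ℕ) : ℝ :=
  ∑ k ∈ Finset.Icc 1 j, inner ℝ (stageDiff U n (k + 1))
    (∑ l ∈ Finset.Icc 1 k, matFun (diffEntry a k l) A (stageDiff U n (l + 1)))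

end EERK

end

open scoped NNReal

noncomputable section

namespace EERK

/-! The DOC kernels `θ` invert the lower triangular array `A` of difference coefficients. Writing v
= A w, the form of D(z) is therefore ⟨v, w⟩ + (z/2)(Σ v_k)², because the entries (z/2)(2 - δ)
symmetrize to a multiple of the all-ones matrix. The rows of `A` are differences of consecutive rows
of the tableau, so S = Σ v_k = Σ_j a_{4j} w_j.

For z = -x, positivity means 2⟨A w, w⟩ - x S² > 0. The left side is the minimum over r of 2⟨A w, w⟩
+ 2 r S + r²/x, which is linear in the coefficients a_{ij}. This bordered form equals x ∫₀^∞ e^{-tx}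
Q(t) dt, where Q is a quadratic form in (w₁, w₂, w₃, r) whose entries are piecewise quadratic in t
with breaks at 3/5, 3/4 and 1. Nonnegativity of Q on each bounded piece follows from that of its
Bernstein coefficients, which are rational 4 × 4 matrices. `coeff32_bordered_form_pos` carries this
for all x > 0 at once.

For the energy, D(-τL_κ) applied to the stage differences gives τ(g_κ(U^k) - ½ L_κ(U^{k+1} + U^k))
(`IsSolution.sum_diffEntry_stageDiff`). Pairing with U^{k+1} - U^k bounds the energy increment by
the descent inequality (`energy_sub_le`). Summing over stages gives the law; its sign follows from
the scalar forms at the negative eigenvalues of -τL_κ. -/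

/-! ### Closed forms of φ₁ and φ₂ on the negative axis -/

theorem phi_one_neg {x : ℝ} (hx : 0 < x) : phi 1 (-x) = (1 - Real.exp (-x)) / x := by
  have h : ∀ s ∈ Set.uIcc (0 : ℝ) 1,
      HasDerivAt (fun s : ℝ => Real.exp ((1 - s) * -x) / x)
        (Real.exp ((1 - s) * -x) * (s ^ 0 / ((0 : ℕ).factorial : ℝ))) s := by
    intro s _
    have h1 : HasDerivAt (fun s : ℝ => (1 - s) * -x) (-1 * -x) s :=
      ((hasDerivAt_id s).const_sub 1).mul_const (-x)
    refine (h1.exp.div_const x).congr_deriv ?_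
    simp only [pow_zero, Nat.factorial_zero, Nat.cast_one]
    field_simp
  rw [phi, intervalIntegral.integral_eq_sub_of_hasDerivAt h
    (Continuous.intervalIntegrable (by fun_prop) _ _)]
  simp
  ring

theorem phi_two_neg {x : ℝ} (hx : 0 < x) : phi 2 (-x) = (x - 1 + Real.exp (-x)) / x ^ 2 := by
  have h : ∀ s ∈ Set.uIcc (0 : ℝ) 1,
      HasDerivAt (fun s : ℝ => Real.exp ((1 - s) * -x) * (s / x - 1 / x ^ 2))
        (Real.exp ((1 - s) * -x) * (s ^ 1 / ((1 : ℕ).factorial : ℝ))) s := by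
    intro s _
    have h1 : HasDerivAt (fun s : ℝ => (1 - s) * -x) (-1 * -x) s :=
      ((hasDerivAt_id s).const_sub 1).mul_const (-x)
    have h2 : HasDerivAt (fun s : ℝ => s / x - 1 / x ^ 2) (1 / x) s :=
      ((hasDerivAt_id s).div_const x).sub_const _
    refine (h1.exp.mul h2).congr_deriv ?_
    simp only [pow_one, Nat.factorial_one, Nat.cast_one]
    field_simp
    ring
  rw [phi, intervalIntegral.integral_eq_sub_of_hasDerivAt h
    (Continuous.intervalIntegrable (by fun_prop) _ _)]
  simp
  field_simp

/-! ### Positivity of exponential integrals from Bernstein coefficients -/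

/-- `x ^ 3` times the integral of `exp (-t x) P(t)` over `[p, q]`, in closed form, where `P` is the
quadratic polynomial with Bernstein coefficients `c₀`, `c₁`, `c₂` on `[p, q]`. -/
def expBernstein (x p q c₀ c₁ c₂ : ℝ) : ℝ :=
  Real.exp (-(p * x)) * (c₀ * x ^ 2 + 2 * (c₁ - c₀) / (q - p) * x
      + 2 * (c₀ - 2 * c₁ + c₂) / (q - p) ^ 2)
    - Real.exp (-(q * x)) * (c₂ * x ^ 2 + 2 * (c₂ - c₁) / (q - p) * x
      + 2 * (c₀ - 2 * c₁ + c₂) / (q - p) ^ 2)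

/-- A polynomial with nonnegative Bernstein coefficients is nonnegative on its interval. No integral
is formed: an explicit antiderivative is monotone, and its endpoint values give the closed form. -/
theorem expBernstein_nonneg {x p q c₀ c₁ c₂ : ℝ} (hx : 0 < x) (hpq : p < q) (h₀ : 0 ≤ c₀)
    (h₁ : 0 ≤ c₁) (h₂ : 0 ≤ c₂) :
    0 ≤ expBernstein x p q c₀ c₁ c₂ := by
  have hd : 0 < q - p := sub_pos.mpr hpq
  let P : ℝ → ℝ := fun t =>
    (c₀ * (q - t) ^ 2 + 2 * c₁ * ((q - t) * (t - p)) + c₂ * (t - p) ^ 2) / (q - p) ^ 2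
  let P' : ℝ → ℝ := fun t =>
    2 * (c₂ * (t - p) + c₁ * (q + p - 2 * t) - c₀ * (q - t)) / (q - p) ^ 2
  let P'' : ℝ := 2 * (c₀ - 2 * c₁ + c₂) / (q - p) ^ 2
  -- Antiderivative of e^{-tx} P(t) x³, obtained by integrating by parts until P is exhausted.
  let Z : ℝ → ℝ := fun t => -(Real.exp (-(t * x)) * (P t * x ^ 2 + P' t * x + P''))
  have hP : ∀ t, HasDerivAt P (P' t) t := by
    intro t
    have ha : HasDerivAt (fun t : ℝ => q - t) (-1) t := (hasDerivAt_id t).const_sub q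
    have hb : HasDerivAt (fun t : ℝ => t - p) 1 t := (hasDerivAt_id t).sub_const p
    refine (((((ha.pow 2).const_mul c₀).add ((ha.mul hb).const_mul (2 * c₁))).add
      ((hb.pow 2).const_mul c₂)).div_const ((q - p) ^ 2)).congr_deriv ?_
    simp only [P']
    push_cast
    ring
  have hP' : ∀ t, HasDerivAt P' P'' t := by
    intro t
    have ha : HasDerivAt (fun t : ℝ => q - t) (-1) t := (hasDerivAt_id t).const_sub q
    have hb : HasDerivAt (fun t : ℝ => t - p) 1 t := (hasDerivAt_id t).sub_const p
    have hc : HasDerivAt (fun t : ℝ => q + p - 2 * t) (-(2 * 1)) t :=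
      ((hasDerivAt_id t).const_mul 2).const_sub (q + p)
    refine (((((hb.const_mul c₂).add (hc.const_mul c₁)).sub (ha.const_mul c₀)).const_mul
      2).div_const ((q - p) ^ 2)).congr_deriv ?_
    simp only [P'']
    ring
  have hZ : ∀ t, HasDerivAt Z (Real.exp (-(t * x)) * P t * x ^ 3) t := by
    intro t
    have he : HasDerivAt (fun t : ℝ => -(t * x)) (-(1 * x)) t :=
      ((hasDerivAt_id t).mul_const x).neg
    refine (he.exp.mul ((((hP t).mul_const (x ^ 2)).add ((hP' t).mul_const x)).add_const
      P'')).neg.congr_deriv ?_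
    simp only [Pi.add_apply]
    ring
  have hmono : MonotoneOn Z (Set.Icc p q) := by
    refine monotoneOn_of_deriv_nonneg (convex_Icc p q)
      (fun t _ => (hZ t).continuousAt.continuousWithinAt)
      (fun t _ => (hZ t).differentiableAt.differentiableWithinAt) fun t ht => ?_
    rw [interior_Icc] at ht
    rw [(hZ t).deriv]
    have h1 : 0 < q - t := sub_pos.mpr ht.2
    have h2 : 0 < t - p := sub_pos.mpr ht.1
    have : 0 ≤ P t := by positivity
    positivity
  have h := hmono (Set.left_mem_Icc.mpr hpq.le) (Set.right_mem_Icc.mpr hpq.le) hpq.le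
  have e1 : P p = c₀ := by simp only [P]; field_simp; ring
  have e2 : P q = c₂ := by simp only [P]; field_simp; ring
  have e3 : P' p = 2 * (c₁ - c₀) / (q - p) := by simp only [P']; field_simp; ring
  have e4 : P' q = 2 * (c₂ - c₁) / (q - p) := by simp only [P']; field_simp; ring
  simp only [Z, e1, e2, e3, e4, P''] at h
  unfold expBernstein
  linarith

/-! ### Nonnegativity of quadratic forms by successive Schur complements -/

theorem quadForm_two_nonneg {a b c : ℝ} (ha : 0 < a) (h : 0 ≤ a * c - b ^ 2) (x y : ℝ) :
    0 ≤ a * x ^ 2 + 2 * b * x * y + c * y ^ 2 := by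
  have e : a * (a * x ^ 2 + 2 * b * x * y + c * y ^ 2) =
      (a * x + b * y) ^ 2 + (a * c - b ^ 2) * y ^ 2 := by ring
  exact nonneg_of_mul_nonneg_right (e ▸ by positivity) ha

theorem quadForm_three_nonneg {a b c d e f : ℝ} (ha : 0 < a) (h₁ : 0 < a * b - d ^ 2)
    (h₂ : 0 ≤ (a * b - d ^ 2) * (a * c - e ^ 2) - (a * f - d * e) ^ 2) (x y z : ℝ) :
    0 ≤ a * x ^ 2 + b * y ^ 2 + c * z ^ 2 + 2 * d * x * y + 2 * e * x * z + 2 * f * y * z := by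
  have h := quadForm_two_nonneg h₁ h₂ y z
  have e : a * (a * x ^ 2 + b * y ^ 2 + c * z ^ 2 + 2 * d * x * y + 2 * e * x * z
      + 2 * f * y * z) = (a * x + d * y + e * z) ^ 2 + ((a * b - d ^ 2) * y ^ 2
      + 2 * (a * f - d * e) * y * z + (a * c - e ^ 2) * z ^ 2) := by ring
  exact nonneg_of_mul_nonneg_right (e ▸ by positivity) ha

/-- The quadratic form of a symmetric `4 × 4` matrix. -/
def quadForm (m₁₁ m₂₂ m₃₃ m₄₄ m₂₁ m₃₁ m₃₂ m₄₁ m₄₂ m₄₃ x y z r : ℝ) : ℝ :=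
  m₁₁ * x ^ 2 + m₂₂ * y ^ 2 + m₃₃ * z ^ 2 + m₄₄ * r ^ 2 + 2 * m₂₁ * x * y + 2 * m₃₁ * x * z
    + 2 * m₃₂ * y * z + 2 * m₄₁ * x * r + 2 * m₄₂ * y * r + 2 * m₄₃ * z * r

/-- Completing the square in r leaves m₄₄ times a Schur complement in (z, y, x). Pivoting from the
last variable up, with denominators cleared, makes every condition a rational inequality. -/
theorem quadForm_nonneg {m₁₁ m₂₂ m₃₃ m₄₄ m₂₁ m₃₁ m₃₂ m₄₁ m₄₂ m₄₃ : ℝ} (h₄ : 0 < m₄₄)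
    (h₃ : 0 < m₄₄ * m₃₃ - m₄₃ ^ 2)
    (h₂ : 0 < (m₄₄ * m₃₃ - m₄₃ ^ 2) * (m₄₄ * m₂₂ - m₄₂ ^ 2) - (m₄₄ * m₃₂ - m₄₂ * m₄₃) ^ 2)
    (h₁ : 0 ≤ ((m₄₄ * m₃₃ - m₄₃ ^ 2) * (m₄₄ * m₂₂ - m₄₂ ^ 2) - (m₄₄ * m₃₂ - m₄₂ * m₄₃) ^ 2)
        * ((m₄₄ * m₃₃ - m₄₃ ^ 2) * (m₄₄ * m₁₁ - m₄₁ ^ 2) - (m₄₄ * m₃₁ - m₄₁ * m₄₃) ^ 2)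
      - ((m₄₄ * m₃₃ - m₄₃ ^ 2) * (m₄₄ * m₂₁ - m₄₁ * m₄₂)
        - (m₄₄ * m₃₂ - m₄₂ * m₄₃) * (m₄₄ * m₃₁ - m₄₁ * m₄₃)) ^ 2) (x y z r : ℝ) :
    0 ≤ quadForm m₁₁ m₂₂ m₃₃ m₄₄ m₂₁ m₃₁ m₃₂ m₄₁ m₄₂ m₄₃ x y z r := by
  have h := quadForm_three_nonneg h₃ h₂ h₁ z y x
  have e : m₄₄ * quadForm m₁₁ m₂₂ m₃₃ m₄₄ m₂₁ m₃₁ m₃₂ m₄₁ m₄₂ m₄₃ x y z r =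
      (m₄₄ * r + m₄₁ * x + m₄₂ * y + m₄₃ * z) ^ 2
        + ((m₄₄ * m₃₃ - m₄₃ ^ 2) * z ^ 2 + (m₄₄ * m₂₂ - m₄₂ ^ 2) * y ^ 2
        + (m₄₄ * m₁₁ - m₄₁ ^ 2) * x ^ 2 + 2 * (m₄₄ * m₃₂ - m₄₂ * m₄₃) * z * y
        + 2 * (m₄₄ * m₃₁ - m₄₁ * m₄₃) * z * x + 2 * (m₄₄ * m₂₁ - m₄₁ * m₄₂) * y * x) := by
    unfold quadForm; ring
  exact nonneg_of_mul_nonneg_right (e ▸ by positivity) h₄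

/-! ### Positivity for the abscissas 3/4 and 3/5 -/

/-- The abscissas `3/4`, `3/5`: the coefficients in closed form at `z = -x < 0`. -/
theorem coeff32_closed {x : ℝ} (hx : 0 < x) :
    coeff32 (3 / 4) (3 / 5) 2 1 (-x) = (1 - Real.exp (-(3 / 4 * x))) / x ∧
    coeff32 (3 / 4) (3 / 5) 3 1 (-x) = (1 - Real.exp (-(3 / 5 * x))) / x
      - (64 / 75 * (3 / 4 * x - 1 + Real.exp (-(3 / 4 * x)))
        + 4 / 3 * (3 / 5 * x - 1 + Real.exp (-(3 / 5 * x)))) / x ^ 2 ∧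
    coeff32 (3 / 4) (3 / 5) 3 2 (-x) =
      (64 / 75 * (3 / 4 * x - 1 + Real.exp (-(3 / 4 * x)))
        + 4 / 3 * (3 / 5 * x - 1 + Real.exp (-(3 / 5 * x)))) / x ^ 2 ∧
    coeff32 (3 / 4) (3 / 5) 4 1 (-x) = (1 - Real.exp (-(1 * x))) / x
      - 41 / 27 * (x - 1 + Real.exp (-(1 * x))) / x ^ 2 ∧
    coeff32 (3 / 4) (3 / 5) 4 2 (-x) = 16 / 27 * (x - 1 + Real.exp (-(1 * x))) / x ^ 2 ∧
    coeff32 (3 / 4) (3 / 5) 4 3 (-x) = 25 / 27 * (x - 1 + Real.exp (-(1 * x))) / x ^ 2 := by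
  have hg : gamma (3 / 4) (3 / 5) = 16 / 25 := by norm_num [gamma]
  have e4 : (3 / 4 : ℝ) * -x = -(3 / 4 * x) := by ring
  have e5 : (3 / 5 : ℝ) * -x = -(3 / 5 * x) := by ring
  have h4 : 0 < 3 / 4 * x := by positivity
  have h5 : 0 < 3 / 5 * x := by positivity
  simp only [coeff32, hg, e4, e5, phi_one_neg hx, phi_one_neg h4, phi_one_neg h5, phi_two_neg hx,
    phi_two_neg h4, phi_two_neg h5, one_mul]
  refine ⟨?_, ?_, ?_, ?_, ?_, ?_⟩ <;> field_simp <;> ring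

theorem coeff32_bordered_form_pos {x : ℝ} (hx : 0 < x) {w₁ w₂ w₃ : ℝ}
    (hw : 0 < w₁ ^ 2 + w₂ ^ 2 + w₃ ^ 2) (r : ℝ) :
    let a := fun i j => coeff32 (3 / 4) (3 / 5) i j (-x)
    0 < 2 * (w₁ * (a 2 1 * w₁) + w₂ * ((a 3 1 - a 2 1) * w₁ + a 3 2 * w₂)
      + w₃ * ((a 4 1 - a 3 1) * w₁ + (a 4 2 - a 3 2) * w₂ + a 4 3 * w₃))
      + 2 * r * (a 4 1 * w₁ + a 4 2 * w₂ + a 4 3 * w₃) + r ^ 2 / x := by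
  intro a
  obtain ⟨h21, h31, h32, h41, h42, h43⟩ := coeff32_closed hx
  -- Bernstein coefficients of Q, with Q(0) = 0. The odd ones `i1`, `i3` are the values at the
  -- breaks 3/5 and 3/4; `i0`, `i2`, `i4` are the middle coefficients on the three pieces; `i6` is
  -- the value at 1. The r² entry of Q is t itself, since r²/x = x ∫₀^∞ e^{-tx} t r² dt.
  have i0 := quadForm_nonneg (m₁₁ := 3 / 5) (m₂₂ := 108 / 125) (m₃₃ := 5 / 9) (m₄₄ := 3 / 10)
    (m₂₁ := -54 / 125) (m₃₁ := -53 / 2250) (m₃₂ := -286 / 1125) (m₄₁ := -7 / 45) (m₄₂ := 8 / 45)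
    (m₄₃ := 5 / 18) (by norm_num) (by norm_num) (by norm_num) (by norm_num) w₁ w₂ w₃ r
  have i1 := quadForm_nonneg (m₁₁ := 6 / 5) (m₂₂ := 588 / 625) (m₃₃ := 7 / 9) (m₄₄ := 3 / 5)
    (m₂₁ := -294 / 625) (m₃₁ := -1883 / 11250) (m₃₂ := -1246 / 5625) (m₄₁ := -17 / 450)
    (m₄₂ := 56 / 225) (m₄₃ := 7 / 18)
    (by norm_num) (by norm_num) (by norm_num) (by norm_num) w₁ w₂ w₃ r
  have i2 := quadForm_nonneg (m₁₁ := 27 / 20) (m₂₂ := 24 / 25) (m₃₃ := 5 / 6) (m₄₄ := 27 / 40)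
    (m₂₁ := -111 / 200) (m₃₁ := -77 / 600) (m₃₂ := -16 / 75) (m₄₁ := -1 / 120) (m₄₂ := 4 / 15)
    (m₄₃ := 5 / 12) (by norm_num) (by norm_num) (by norm_num) (by norm_num) w₁ w₂ w₃ r
  have i3 := quadForm_nonneg (m₁₁ := 3 / 2) (m₂₂ := 24 / 25) (m₃₃ := 125 / 144) (m₄₄ := 3 / 4)
    (m₂₁ := -63 / 100) (m₃₁ := -589 / 7200) (m₃₂ := -91 / 450) (m₄₁ := 11 / 288) (m₄₂ := 5 / 18)
    (m₄₃ := 125 / 288) (by norm_num) (by norm_num) (by norm_num) (by norm_num) w₁ w₂ w₃ r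
  have i4 := quadForm_nonneg (m₁₁ := 3 / 2) (m₂₂ := 24 / 25) (m₃₃ := 25 / 27) (m₄₄ := 7 / 8)
    (m₂₁ := -63 / 100) (m₃₁ := -23 / 5400) (m₃₂ := -124 / 675) (m₄₁ := 25 / 216) (m₄₂ := 8 / 27)
    (m₄₃ := 25 / 54) (by norm_num) (by norm_num) (by norm_num) (by norm_num) w₁ w₂ w₃ r
  -- Subtracting (w₁² + w₂² + w₃²)/10 from Q(1) leaves it nonnegative, so `hw` makes Q(1) strictly
  -- positive. This is the source of strictness.
  have i5 := quadForm_nonneg (m₁₁ := 3 / 2 - 1 / 10) (m₂₂ := 24 / 25 - 1 / 10)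
    (m₃₃ := 25 / 27 - 1 / 10) (m₄₄ := 1)
    (m₂₁ := -63 / 100) (m₃₁ := 163 / 1350) (m₃₂ := -124 / 675) (m₄₁ := 13 / 54) (m₄₂ := 8 / 27)
    (m₄₃ := 25 / 54) (by norm_num) (by norm_num) (by norm_num) (by norm_num) w₁ w₂ w₃ r
  have i6 : 0 < quadForm (3 / 2) (24 / 25) (25 / 27) 1 (-63 / 100) (163 / 1350) (-124 / 675)
      (13 / 54) (8 / 27) (25 / 54) w₁ w₂ w₃ r := by
    unfold quadForm at i5 ⊢
    linarith
  have j0 := expBernstein_nonneg (p := 0) (q := 3 / 5) hx (by norm_num) le_rfl i0 i1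
  have j1 := expBernstein_nonneg (p := 3 / 5) (q := 3 / 4) hx (by norm_num) i1 i2 i3
  have j2 := expBernstein_nonneg (p := 3 / 4) (q := 1) hx (by norm_num) i3 i4 i6.le
  have hE := Real.exp_pos (-(1 * x))
  -- For t ≥ 1 one has Q(t) = Q(1) + (t - 1) r²; `j3` and `j4` are the two parts of this tail
  -- integral.
  have j3 := mul_pos (mul_pos hE (pow_pos hx 2)) i6
  have j4 : 0 ≤ Real.exp (-(1 * x)) * x * r ^ 2 := by positivity
  have j := add_pos_of_pos_of_nonneg (add_pos_of_nonneg_of_pos (add_nonneg (add_nonneg j0 j1) j2)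
    j3) j4
  refine pos_of_mul_pos_right (lt_of_lt_of_eq j ?_) (sq_nonneg x)
  simp only [a, h21, h31, h32, h41, h42, h43, expBernstein, quadForm, zero_mul, neg_zero,
    Real.exp_zero]
  generalize Real.exp (-(1 * x)) = E₁
  generalize Real.exp (-(3 / 4 * x)) = E₂
  generalize Real.exp (-(3 / 5 * x)) = E₃
  field_simp
  ring

theorem coeff32_form_pos {x : ℝ} (hx : 0 < x) {w₁ w₂ w₃ : ℝ}
    (hw : 0 < w₁ ^ 2 + w₂ ^ 2 + w₃ ^ 2) :
    let a := fun i j => coeff32 (3 / 4) (3 / 5) i j (-x)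
    0 < w₁ * (a 2 1 * w₁) + w₂ * ((a 3 1 - a 2 1) * w₁ + a 3 2 * w₂)
      + w₃ * ((a 4 1 - a 3 1) * w₁ + (a 4 2 - a 3 2) * w₂ + a 4 3 * w₃)
      - x / 2 * (a 4 1 * w₁ + a 4 2 * w₂ + a 4 3 * w₃) ^ 2 := by
  intro a
  -- The minimizer r = -x S of 2 r S + r²/x.
  have h := coeff32_bordered_form_pos hx hw (-x * (a 4 1 * w₁ + a 4 2 * w₂ + a 4 3 * w₃))
  have e : (-x * (a 4 1 * w₁ + a 4 2 * w₂ + a 4 3 * w₃)) ^ 2 / x =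
      x * (a 4 1 * w₁ + a 4 2 * w₂ + a 4 3 * w₃) ^ 2 := by field_simp
  simp only [a] at h e ⊢
  rw [e] at h
  linarith

theorem coeff32_diag_pos {x : ℝ} (hx : 0 < x) :
    0 < coeff32 (3 / 4) (3 / 5) 2 1 (-x) ∧ 0 < coeff32 (3 / 4) (3 / 5) 3 2 (-x) ∧
      0 < coeff32 (3 / 4) (3 / 5) 4 3 (-x) := by
  obtain ⟨h21, -, h32, -, -, h43⟩ := coeff32_closed hx
  have key : ∀ c : ℝ, 0 < c → 0 < c * x - 1 + Real.exp (-(c * x)) := fun c hc => by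
    have := Real.add_one_lt_exp (neg_ne_zero.mpr (mul_pos hc hx).ne')
    linarith
  have h1 := key 1 one_pos
  have h2 := key (3 / 4) (by norm_num)
  have h3 := key (3 / 5) (by norm_num)
  have h4 : 0 < 1 - Real.exp (-(3 / 4 * x)) :=
    sub_pos.mpr (Real.exp_lt_one_iff.mpr (neg_neg_of_pos (by positivity)))
  rw [one_mul] at h1
  rw [h21, h32, h43, one_mul]
  exact ⟨by positivity, by positivity, by positivity⟩

/-! ### The quadratic form of the differentiation matrix -/

/-- The DOC kernels invert the lower triangular array that they are built from. -/
theorem sum_docKernel_mul (b : ℕ → ℕ → ℝ) {v F : ℕ → ℝ} {k : ℕ} (hk : 1 ≤ k)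
    (hb : ∀ j ∈ Finset.Icc 1 k, b (j + 1) j ≠ 0)
    (hv : ∀ l ∈ Finset.Icc 1 k, v l = ∑ j ∈ Finset.Icc 1 l, b (l + 1) j * F j) :
    ∑ l ∈ Finset.Icc 1 k, docKernel b k l * v l = F k := by
  have horth : ∀ j ∈ Finset.Icc 1 k,
      ∑ l ∈ Finset.Icc j k, docKernel b k l * b (l + 1) j = if j = k then 1 else 0 := by
    intro j hj
    have hjk := (Finset.mem_Icc.mp hj).2
    split_ifs with h
    · subst h
      simp [docKernel_self, hb j hj]
    · have hlt : j < k := lt_of_le_of_ne hjk h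
      have hIcc : Finset.Icc j k = insert j (Finset.Icc (j + 1) k) := by
        ext l; simp only [Finset.mem_insert, Finset.mem_Icc]; omega
      rw [hIcc, Finset.sum_insert (by simp), docKernel_of_lt b hlt, neg_mul, Finset.sum_mul,
        neg_add_eq_zero]
      refine Finset.sum_congr rfl fun l _ => ?_
      have := hb j hj
      field_simp
  calc ∑ l ∈ Finset.Icc 1 k, docKernel b k l * v l
      = ∑ l ∈ Finset.Icc 1 k, ∑ j ∈ Finset.Icc 1 l, docKernel b k l * (b (l + 1) j * F j) :=
        Finset.sum_congr rfl fun l hl => by rw [hv l hl, Finset.mul_sum]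
    _ = ∑ j ∈ Finset.Icc 1 k, ∑ l ∈ Finset.Icc j k, docKernel b k l * (b (l + 1) j * F j) := by
        refine Finset.sum_comm' fun l j => ?_
        simp only [Finset.mem_Icc]; omega
    _ = ∑ j ∈ Finset.Icc 1 k, (if j = k then F j else 0) := by
        refine Finset.sum_congr rfl fun j hj => ?_
        simp only [← mul_assoc]
        rw [← Finset.sum_mul, horth j hj]
        split_ifs <;> simp
    _ = F k := by simp [hk]

/-- The kernels recover `F k`, and the factor 2 - δ contributes z times the partial sum of `v`, with
half of the last term removed. This serves both the scalar form and the stage equations. -/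
theorem sum_diffEntry_mul (a : ℕ → ℕ → ℝ → ℝ) {z : ℝ} {v F : ℕ → ℝ} {k : ℕ} (hk : 1 ≤ k)
    (ha : ∀ j ∈ Finset.Icc 1 k, a (j + 1) j z ≠ 0)
    (hv : ∀ l ∈ Finset.Icc 1 k, v l = ∑ j ∈ Finset.Icc 1 l, diffCoeff a (l + 1) j z * F j) :
    ∑ l ∈ Finset.Icc 1 k, diffEntry a k l z * v l =
      F k + z * ∑ l ∈ Finset.Icc 1 k, v l - z / 2 * v k := by
  have h := sum_docKernel_mul (fun i j => diffCoeff a i j z) hk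
    (fun j hj => by simpa [diffCoeff] using ha j hj) hv
  have e : ∀ l ∈ Finset.Icc 1 k, diffEntry a k l z * v l =
      docKernel (fun i j => diffCoeff a i j z) k l * v l + z * v l
        - (if k = l then z / 2 * v l else 0) := by
    intro l hl
    rw [diffEntry, if_pos (Finset.mem_Icc.mp hl).2]
    split_ifs <;> ring
  rw [Finset.sum_congr rfl e, Finset.sum_sub_distrib, Finset.sum_add_distrib, h,
    ← Finset.mul_sum]
  simp [hk]

/-- The quadratic form of the differentiation matrix. -/
def diffForm (a : ℕ → ℕ → ℝ → ℝ) (z : ℝ) (s : ℕ) (v : ℕ → ℝ) : ℝ :=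
  ∑ k ∈ Finset.Icc 1 s, v k * ∑ l ∈ Finset.Icc 1 k, diffEntry a k l z * v l

theorem coeff32_diffForm_pos {z : ℝ} (hz : z < 0) {v : ℕ → ℝ}
    (hv : v 1 ≠ 0 ∨ v 2 ≠ 0 ∨ v 3 ≠ 0) :
    0 < diffForm (coeff32 (3 / 4) (3 / 5)) z 3 v := by
  obtain ⟨x, rfl⟩ : ∃ x, z = -x := ⟨-z, by ring⟩
  have hx : 0 < x := by linarith
  obtain ⟨p1, p2, p3⟩ := coeff32_diag_pos hx
  set a := coeff32 (3 / 4) (3 / 5) with ha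
  -- Forward substitution for v = A w, possible since the diagonal of `A` is positive.
  obtain ⟨w₁, h₁⟩ : ∃ w, v 1 = a 2 1 (-x) * w := ⟨v 1 / a 2 1 (-x), by field_simp⟩
  obtain ⟨w₂, h₂⟩ : ∃ w, v 2 = (a 3 1 (-x) - a 2 1 (-x)) * w₁ + a 3 2 (-x) * w :=
    ⟨(v 2 - (a 3 1 (-x) - a 2 1 (-x)) * w₁) / a 3 2 (-x), by field_simp; ring⟩
  obtain ⟨w₃, h₃⟩ : ∃ w, v 3 = (a 4 1 (-x) - a 3 1 (-x)) * w₁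
      + (a 4 2 (-x) - a 3 2 (-x)) * w₂ + a 4 3 (-x) * w :=
    ⟨(v 3 - (a 4 1 (-x) - a 3 1 (-x)) * w₁ - (a 4 2 (-x) - a 3 2 (-x)) * w₂) / a 4 3 (-x), by
      field_simp; ring⟩
  have hw : 0 < w₁ ^ 2 + w₂ ^ 2 + w₃ ^ 2 := by
    by_contra hn
    have e1 : w₁ = 0 := by nlinarith [sq_nonneg w₁, sq_nonneg w₂, sq_nonneg w₃]
    have e2 : w₂ = 0 := by nlinarith [sq_nonneg w₁, sq_nonneg w₂, sq_nonneg w₃]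
    have e3 : w₃ = 0 := by nlinarith [sq_nonneg w₁, sq_nonneg w₂, sq_nonneg w₃]
    subst e1 e2 e3
    simp [h₁, h₂, h₃] at hv
  let F : ℕ → ℝ := fun k => if k = 1 then w₁ else if k = 2 then w₂ else w₃
  have hF : ∀ l ∈ Finset.Icc 1 3,
      v l = ∑ j ∈ Finset.Icc 1 l, diffCoeff a (l + 1) j (-x) * F j := by
    intro l hl
    obtain ⟨hl1, hl3⟩ := Finset.mem_Icc.mp hl
    interval_cases l
    · simp [diffCoeff, F, h₁]
    · simp [Finset.sum_Icc_succ_top, diffCoeff, F, h₂]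
    · simp [Finset.sum_Icc_succ_top, diffCoeff, F, h₃]
  have hdiag : ∀ j ∈ Finset.Icc 1 3, a (j + 1) j (-x) ≠ 0 := by
    intro j hj
    obtain ⟨hj1, hj3⟩ := Finset.mem_Icc.mp hj
    interval_cases j
    exacts [p1.ne', p2.ne', p3.ne']
  have hsum : ∀ k ∈ Finset.Icc 1 3, ∑ l ∈ Finset.Icc 1 k, diffEntry a k l (-x) * v l =
      F k + -x * ∑ l ∈ Finset.Icc 1 k, v l - -x / 2 * v k := fun k hk =>
    have hsub := Finset.Icc_subset_Icc_right (a := 1) (Finset.mem_Icc.mp hk).2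
    sum_diffEntry_mul a (Finset.mem_Icc.mp hk).1 (fun j hj => hdiag j (hsub hj))
      fun l hl => hF l (hsub hl)
  have h := coeff32_form_pos hx hw
  rw [diffForm, Finset.sum_congr rfl fun k hk => by rw [hsum k hk]]
  refine lt_of_lt_of_eq h ?_
  simp only [Finset.sum_Icc_succ_top, Nat.reduceLeDiff, Finset.Icc_self, Finset.sum_singleton,
    Nat.reduceAdd, F, h₁, h₂, h₃, ← ha]
  norm_num
  ring

theorem coeff32_diffForm_nonneg {z : ℝ} (hz : z < 0) {s : ℕ} (hs : s ≤ 3) (v : ℕ → ℝ) :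
    0 ≤ diffForm (coeff32 (3 / 4) (3 / 5)) z s v := by
  -- Extension by zero: the form on the first `s` indices is a leading block of the full one, so the
  -- three-stage positivity covers the intermediate stages.
  let v' : ℕ → ℝ := fun k => if k ≤ s then v k else 0
  have e : diffForm (coeff32 (3 / 4) (3 / 5)) z s v =
      diffForm (coeff32 (3 / 4) (3 / 5)) z 3 v' := by
    refine Finset.sum_congr_of_eq_on_inter ?_ ?_ ?_
    · intro k hk hk'
      exact absurd (Finset.Icc_subset_Icc_right hs hk) hk'
    · intro k hk hk'
      have : ¬ k ≤ s := fun h => hk' (Finset.mem_Icc.mpr ⟨(Finset.mem_Icc.mp hk).1, h⟩)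
      simp [v', this]
    · intro k hk _
      have hks := (Finset.mem_Icc.mp hk).2
      simp only [v', if_pos hks]
      congr 1
      refine Finset.sum_congr rfl fun l hl => ?_
      rw [if_pos ((Finset.mem_Icc.mp hl).2.trans hks)]
  rw [e]
  by_cases h : v' 1 ≠ 0 ∨ v' 2 ≠ 0 ∨ v' 3 ≠ 0
  · exact (coeff32_diffForm_pos hz h).le
  · push Not at h
    refine (Finset.sum_eq_zero fun k hk => ?_).ge
    obtain ⟨h1, h3⟩ := Finset.mem_Icc.mp hk
    interval_cases k <;> simp [h]

theorem symPart_coeff32_posDef {z : ℝ} (hz : z < 0) :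
    (symPart (diffMatrix (coeff32 (3 / 4) (3 / 5)) 3 z)).PosDef := by
  refine Matrix.PosDef.of_dotProduct_mulVec_pos ?_ fun x hx => ?_
  · ext i j
    simp [symPart, ← mul_add, add_comm]
  · let v : ℕ → ℝ := fun k => if k = 1 then x 0 else if k = 2 then x 1 else x 2
    have hv : v 1 ≠ 0 ∨ v 2 ≠ 0 ∨ v 3 ≠ 0 := by
      by_contra hn
      push Not at hn
      refine hx (funext fun i => ?_)
      fin_cases i
      exacts [hn.1, hn.2.1, hn.2.2]
    refine lt_of_lt_of_eq (coeff32_diffForm_pos hz hv) ?_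
    have d12 : diffEntry (coeff32 (3 / 4) (3 / 5)) 1 2 z = 0 := by simp [diffEntry]
    have d13 : diffEntry (coeff32 (3 / 4) (3 / 5)) 1 3 z = 0 := by simp [diffEntry]
    have d23 : diffEntry (coeff32 (3 / 4) (3 / 5)) 2 3 z = 0 := by simp [diffEntry]
    simp only [diffForm, Finset.sum_Icc_succ_top, Nat.reduceLeDiff, Finset.Icc_self,
      Finset.sum_singleton, Nat.reduceAdd, v, symPart, diffMatrix, dotProduct, Matrix.mulVec,
      Fin.sum_univ_three, Matrix.smul_apply, Matrix.add_apply, Matrix.transpose_apply,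
      Matrix.of_apply, Pi.star_apply, star_trivial, smul_eq_mul]
    norm_num [d12, d13, d23]
    ring

/-! ### Functions of a symmetric matrix in an eigenbasis -/

theorem matFun_eigenvectorBasis {M : ℕ} {A : Matrix (Fin M) (Fin M) ℝ} (hA : A.IsHermitian)
    (f : ℝ → ℝ) (i : Fin M) :
    matFun f A (hA.eigenvectorBasis i) = f (hA.eigenvalues i) • hA.eigenvectorBasis i := by
  rw [matFun, hA.cfc_eq, Matrix.IsHermitian.cfc, Unitary.conjStarAlgAut_apply]
  ext1 m
  have h := hA.star_eigenvectorUnitary_mulVec i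
  have h' : ((hA.eigenvectorUnitary : Matrix (Fin M) (Fin M) ℝ) *
      Matrix.diagonal (RCLike.ofReal ∘ f ∘ hA.eigenvalues) *
      star (hA.eigenvectorUnitary : Matrix (Fin M) (Fin M) ℝ)).mulVec
        (hA.eigenvectorBasis i).ofLp =
      f (hA.eigenvalues i) • (hA.eigenvectorBasis i).ofLp := by
    rw [← Matrix.mulVec_mulVec, h, ← Matrix.mulVec_mulVec, Matrix.diagonal_mulVec_single, mul_one,
      ← hA.eigenvectorUnitary_mulVec i, ← Matrix.mulVec_smul]
    congr 1
    ext k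
    simp [Pi.single_apply]
  exact congrFun h' m

theorem inner_eigenvectorBasis_matFun {M : ℕ} {A : Matrix (Fin M) (Fin M) ℝ}
    (hA : A.IsHermitian) (f : ℝ → ℝ) (i : Fin M) (v : EuclideanSpace ℝ (Fin M)) :
    inner ℝ (hA.eigenvectorBasis i) (matFun f A v) =
      f (hA.eigenvalues i) * inner ℝ (hA.eigenvectorBasis i) v := by
  have hs : (cfc f A).IsHermitian := cfc_predicate f A
  have h := (Matrix.isSymmetric_toEuclideanLin_iff.mpr hs) (hA.eigenvectorBasis i) v
  rw [matFun, ← h, ← matFun, matFun_eigenvectorBasis, real_inner_smul_left]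

theorem inner_eigenvectorBasis_toEuclideanLin {M : ℕ} {A : Matrix (Fin M) (Fin M) ℝ}
    (hA : A.IsHermitian) (i : Fin M) (v : EuclideanSpace ℝ (Fin M)) :
    inner ℝ (hA.eigenvectorBasis i) (Matrix.toEuclideanLin A v) =
      hA.eigenvalues i * inner ℝ (hA.eigenvectorBasis i) v := by
  have h := (Matrix.isSymmetric_toEuclideanLin_iff.mpr hA) (hA.eigenvectorBasis i) v
  have e : Matrix.toEuclideanLin A (hA.eigenvectorBasis i) =
      hA.eigenvalues i • hA.eigenvectorBasis i := by
    ext m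
    exact congrFun (hA.mulVec_eigenvectorBasis i) m
  rw [← h, e, real_inner_smul_left]

theorem eigenvalues_neg_of_posDef {M : ℕ} {B : Matrix (Fin M) (Fin M) ℝ} (hB : B.PosDef)
    (hA : (-B).IsHermitian) (i : Fin M) : hA.eigenvalues i < 0 := by
  have h1 := hA.eigenvalues_eq i
  have h2 := hB.dotProduct_mulVec_pos (x := (hA.eigenvectorBasis i).ofLp) fun h =>
    hA.eigenvectorBasis.orthonormal.ne_zero i (by ext m; simpa using congrFun h m)
  rw [h1]
  simpa [Matrix.neg_mulVec, dotProduct_neg] using h2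

/-- The dissipation is a sum of scalar quadratic forms over the eigenvalues. -/
theorem dissipation_eq_sum_diffForm {M : ℕ} (a : ℕ → ℕ → ℝ → ℝ) {A : Matrix (Fin M) (Fin M) ℝ}
    (hA : A.IsHermitian) (U : ℕ → ℕ → EuclideanSpace ℝ (Fin M)) (n j : ℕ) :
    dissipation a A U n j = ∑ i, diffForm a (hA.eigenvalues i) j
      (fun k => inner ℝ (hA.eigenvectorBasis i) (stageDiff U n (k + 1))) := by
  simp only [diffForm, dissipation]
  rw [Finset.sum_comm]
  refine Finset.sum_congr rfl fun k _ => ?_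
  rw [← hA.eigenvectorBasis.sum_inner_mul_inner]
  refine Finset.sum_congr rfl fun i _ => ?_
  rw [real_inner_comm, inner_sum]
  simp only [inner_eigenvectorBasis_matFun]

theorem dissipation_nonneg {M : ℕ} {a : ℕ → ℕ → ℝ → ℝ} {B : Matrix (Fin M) (Fin M) ℝ}
    (hB : B.PosDef) (U : ℕ → ℕ → EuclideanSpace ℝ (Fin M)) (n : ℕ) {j : ℕ}
    (ha : ∀ z < 0, ∀ v, 0 ≤ diffForm a z j v) : 0 ≤ dissipation a (-B) U n j := by
  have hA : (-B).IsHermitian := hB.isHermitian.neg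
  rw [dissipation_eq_sum_diffForm a hA]
  exact Finset.sum_nonneg fun i _ => ha _ (eigenvalues_neg_of_posDef hB hA i) _

/-! ### The method in terms of the stage differences -/

theorem sum_stageDiff {M : ℕ} (U : ℕ → ℕ → EuclideanSpace ℝ (Fin M)) (n k : ℕ) :
    ∑ l ∈ Finset.Icc 1 k, stageDiff U n (l + 1) = U n (k + 1) - U n 1 := by
  induction k with
  | zero => simp
  | succ k ih => rw [Finset.sum_Icc_succ_top (by omega), ih]; simp [stageDiff]

/-- The increment of a stage in terms of the difference coefficients. -/
theorem sub_eq_sum_diffCoeff {a : ℕ → ℕ → ℝ → ℝ} {z : ℝ} {U F : ℕ → ℝ} {k : ℕ} (hk : 1 ≤ k)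
    (hU : ∀ i, 1 ≤ i → i ≤ k → U (i + 1) = U 1 + ∑ j ∈ Finset.Icc 1 i, a (i + 1) j z * F j) :
    U (k + 1) - U k = ∑ j ∈ Finset.Icc 1 k, diffCoeff a (k + 1) j z * F j := by
  obtain ⟨m, rfl⟩ : ∃ m, k = m + 1 := ⟨k - 1, by omega⟩
  have hprev : U (m + 1) = U 1 + ∑ j ∈ Finset.Icc 1 m, a (m + 1) j z * F j := by
    -- For m = 0 the sum is empty, so the stage equation is needed only from the second stage on.
    rcases Nat.eq_zero_or_pos m with rfl | hm
    · simp
    · exact hU m hm (by omega)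
  rw [hU (m + 1) hk le_rfl, hprev, Finset.sum_Icc_succ_top (by omega),
    Finset.sum_Icc_succ_top (by omega)]
  have e : ∀ j ∈ Finset.Icc 1 m, diffCoeff a (m + 1 + 1) j z * F j =
      a (m + 1 + 1) j z * F j - a (m + 1) j z * F j := by
    intro j hj
    have := (Finset.mem_Icc.mp hj).2
    rw [diffCoeff, if_neg (by omega), if_pos (by omega)]
    ring
  rw [Finset.sum_congr rfl e, Finset.sum_sub_distrib]
  simp only [diffCoeff, if_true]
  ring

/-- The differentiation matrix applied to the stage differences. -/
theorem IsSolution.sum_diffEntry_stageDiff {M s : ℕ} {a : ℕ → ℕ → ℝ → ℝ}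
    {L : Matrix (Fin M) (Fin M) ℝ} {g : EuclideanSpace ℝ (Fin M) → EuclideanSpace ℝ (Fin M)}
    {τ : ℕ → ℝ} {u : ℕ → EuclideanSpace ℝ (Fin M)} {U : ℕ → ℕ → EuclideanSpace ℝ (Fin M)}
    (hsol : IsSolution s a L g τ u U) (hL : L.PosDef)
    (ha : ∀ z < 0, ∀ j ∈ Finset.Icc 1 s, a (j + 1) j z ≠ 0)
    {n k : ℕ} (hn : 1 ≤ n) (hτ : 0 < τ n) (hk : 1 ≤ k) (hks : k ≤ s) :
    ∑ l ∈ Finset.Icc 1 k, matFun (diffEntry a k l) (-(τ n • L)) (stageDiff U n (l + 1)) =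
      τ n • (g (U n k) - (1 / 2 : ℝ) • Matrix.toEuclideanLin L (U n (k + 1) + U n k)) := by
  have hB : (τ n • L).PosDef := hL.smul hτ
  have hA : (-(τ n • L)).IsHermitian := hB.isHermitian.neg
  have hAL : ∀ v, Matrix.toEuclideanLin (-(τ n • L)) v = -(τ n • Matrix.toEuclideanLin L v) :=
    fun v => by simp
  refine hA.eigenvectorBasis.repr.injective (PiLp.ext fun i => ?_)
  rw [hA.eigenvectorBasis.repr_apply_apply, hA.eigenvectorBasis.repr_apply_apply]
  set e := hA.eigenvectorBasis i with he
  set z := hA.eigenvalues i with hz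
  have hzneg : z < 0 := eigenvalues_neg_of_posDef hB hA i
  let F : ℕ → ℝ := fun j =>
    inner ℝ e (τ n • g (U n j) - τ n • Matrix.toEuclideanLin L (U n 1))
  have hU : ∀ m, 1 ≤ m → m ≤ s → inner ℝ e (U n (m + 1)) =
      inner ℝ e (U n 1) + ∑ j ∈ Finset.Icc 1 m, a (m + 1) j z * F j := by
    intro m hm hms
    rw [hsol.stage n hn m hm hms, inner_add_right, inner_sum]
    simp only [he, inner_eigenvectorBasis_matFun, F, z]
  have hv : ∀ l ∈ Finset.Icc 1 k, inner ℝ e (stageDiff U n (l + 1)) =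
      ∑ j ∈ Finset.Icc 1 l, diffCoeff a (l + 1) j z * F j := by
    intro l hl
    obtain ⟨hl1, hlk⟩ := Finset.mem_Icc.mp hl
    rw [stageDiff, Nat.add_sub_cancel, inner_sub_right]
    exact sub_eq_sum_diffCoeff (U := fun m => inner ℝ e (U n m)) hl1
      fun m hm hml => hU m hm (by omega)
  have h := sum_diffEntry_mul a hk
    (fun j hj => ha z hzneg j (Finset.Icc_subset_Icc_right hks hj)) hv
  have hz1 : ∀ v, z * inner ℝ e v = -(τ n * inner ℝ e (Matrix.toEuclideanLin L v)) := by
    intro v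
    rw [hz, he, ← inner_eigenvectorBasis_toEuclideanLin hA, hAL, inner_neg_right,
      real_inner_smul_right]
  rw [inner_sum]
  simp only [he, inner_eigenvectorBasis_matFun]
  rw [← he, ← hz, h, ← inner_sum, sum_stageDiff, stageDiff, Nat.add_sub_cancel]
  have h1 := hz1 (U n (k + 1))
  have h2 := hz1 (U n k)
  have h3 := hz1 (U n 1)
  simp only [F, map_add, inner_sub_right, inner_add_right, real_inner_smul_right, smul_add,
    smul_sub, mul_sub] at h1 h2 h3 ⊢
  -- The contributions of U^{n,1} cancel, and z U^{k+1} - (z/2)(U^{k+1} - U^k) becomes the midpoint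
  -- term (z/2)(U^{k+1} + U^k).
  linear_combination (1 / 2) * h1 + (1 / 2) * h2 - h3

/-! ### The energy -/

/-- The descent inequality for a function with Lipschitz continuous gradient. -/
theorem le_add_inner_add_of_lipschitz_gradient {E : Type*} [NormedAddCommGroup E]
    [InnerProductSpace ℝ E] [CompleteSpace E] {P : E → ℝ} {g : E → E} {K : ℝ≥0}
    (hP : ∀ v, HasGradientAt P (g v) v) (hg : LipschitzWith K g) (v w : E) :
    P w ≤ P v + inner ℝ (g v) (w - v) + K / 2 * ‖w - v‖ ^ 2 := by
  set d := w - v with hd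
  -- P along the segment minus the linear and quadratic parts of the bound; the Lipschitz condition
  -- makes its derivative nonpositive.
  let h : ℝ → ℝ := fun t => P (v + t • d) - t * inner ℝ (g v) d - K / 2 * ‖d‖ ^ 2 * t ^ 2
  have hder : ∀ t, HasDerivAt h
      (inner ℝ (g (v + t • d)) d - inner ℝ (g v) d - K / 2 * ‖d‖ ^ 2 * (2 * t)) t := by
    intro t
    have h1 : HasDerivAt (fun t : ℝ => v + t • d) d t := by
      simpa using ((hasDerivAt_id t).smul_const d).const_add v
    have h2 := (hP (v + t • d)).hasFDerivAt.comp_hasDerivAt t h1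
    have h3 := (hasDerivAt_id t).mul_const (inner ℝ (g v) d)
    have h4 := ((hasDerivAt_id t).pow 2).const_mul (K / 2 * ‖d‖ ^ 2)
    refine ((h2.sub h3).sub h4).congr_deriv ?_
    simp
  have hanti : AntitoneOn h (Set.Icc 0 1) := by
    refine antitoneOn_of_deriv_nonpos (convex_Icc 0 1)
      (fun t _ => (hder t).continuousAt.continuousWithinAt)
      (fun t _ => (hder t).differentiableAt.differentiableWithinAt) fun t ht => ?_
    rw [interior_Icc] at ht
    rw [(hder t).deriv, ← inner_sub_left]
    have h1 := real_inner_le_norm (g (v + t • d) - g v) d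
    have h2 : ‖g (v + t • d) - g v‖ ≤ K * (t * ‖d‖) := by
      have := hg.norm_sub_le (v + t • d) v
      rwa [add_sub_cancel_left, norm_smul, Real.norm_of_nonneg ht.1.le] at this
    have h3 := mul_le_mul_of_nonneg_right h2 (norm_nonneg d)
    nlinarith
  have h01 := hanti (Set.left_mem_Icc.mpr zero_le_one) (Set.right_mem_Icc.mpr zero_le_one)
    zero_le_one
  simp only [h, zero_smul, add_zero, one_smul, hd, add_sub_cancel] at h01
  linarith

/-- The quadratic energy changes by exactly ½⟨w - v, L(w + v)⟩. The two stabilizing terms on the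
right combine to (κ/2)‖w - v‖², which absorbs the remainder (ℓ_g/2)‖w - v‖² of the descent
inequality. -/
theorem energy_sub_le {M : ℕ} {L : Matrix (Fin M) (Fin M) ℝ}
    {g G : EuclideanSpace ℝ (Fin M) → EuclideanSpace ℝ (Fin M)} {lip : ℝ≥0} {κ : ℝ}
    (hL : L.IsHermitian) (hG : ∀ v, HasGradientAt (potential G) (-(g v)) v)
    (hg : LipschitzWith lip g) (hκ : (lip : ℝ) ≤ κ) (v w : EuclideanSpace ℝ (Fin M)) :
    energy L G w - energy L G v ≤ -inner ℝ (w - v)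
      (stabG κ g v - (1 / 2 : ℝ) • Matrix.toEuclideanLin (stabL κ L) (w + v)) := by
  have hd := le_add_inner_add_of_lipschitz_gradient (K := lip) hG
    (LipschitzWith.of_dist_le_mul fun x y => by
      rw [dist_neg_neg]; exact hg.dist_le_mul x y) v w
  have hs := (Matrix.isSymmetric_toEuclideanLin_iff.mpr hL) v w
  have hstab : ∀ x, Matrix.toEuclideanLin (stabL κ L) x = Matrix.toEuclideanLin L x + κ • x := by
    intro x
    simp [stabL]
  have hn : ‖w - v‖ ^ 2 = inner ℝ w w - 2 * inner ℝ v w + inner ℝ v v := by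
    rw [← real_inner_self_eq_norm_sq, inner_sub_left, inner_sub_right, inner_sub_right,
      real_inner_comm v w]
    ring
  have hle : (lip : ℝ) / 2 * ‖w - v‖ ^ 2 ≤ κ / 2 * ‖w - v‖ ^ 2 := by gcongr
  have c1 := real_inner_comm v (Matrix.toEuclideanLin L w)
  have c2 := real_inner_comm w (Matrix.toEuclideanLin L v)
  have c3 := real_inner_comm v w
  have c4 := real_inner_comm (g v) w
  have c5 := real_inner_comm (g v) v
  rw [hn] at hle hd
  simp only [energy, stabG, hstab, map_add, inner_sub_left, inner_sub_right, inner_add_right,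
    real_inner_smul_right, inner_neg_left, smul_add] at hd ⊢
  nlinarith

theorem IsSolution.energy_sub_le_dissipation {M s : ℕ} {a : ℕ → ℕ → ℝ → ℝ}
    {L : Matrix (Fin M) (Fin M) ℝ} {g G : EuclideanSpace ℝ (Fin M) → EuclideanSpace ℝ (Fin M)}
    {lip : ℝ≥0} {κ : ℝ} {τ : ℕ → ℝ} {u : ℕ → EuclideanSpace ℝ (Fin M)}
    {U : ℕ → ℕ → EuclideanSpace ℝ (Fin M)}
    (hsol : IsSolution s a (stabL κ L) (stabG κ g) τ u U) (hL : L.IsHermitian)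
    (hLκ : (stabL κ L).PosDef) (hG : ∀ v, HasGradientAt (potential G) (-(g v)) v)
    (hg : LipschitzWith lip g) (hκ : (lip : ℝ) ≤ κ)
    (ha : ∀ z < 0, ∀ j ∈ Finset.Icc 1 s, a (j + 1) j z ≠ 0)
    {n j : ℕ} (hn : 1 ≤ n) (hτ : 0 < τ n) (hj : j ≤ s) :
    energy L G (U n (j + 1)) - energy L G (U n 1) ≤
      -(1 / τ n) * dissipation a (-(τ n • stabL κ L)) U n j := by
  induction j with
  | zero => simp [dissipation]
  | succ k ih =>
    have h1 := ih (by omega)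
    have h2 := energy_sub_le hL hG hg hκ (U n (k + 1)) (U n (k + 1 + 1))
    have h3 : dissipation a (-(τ n • stabL κ L)) U n (k + 1) =
        dissipation a (-(τ n • stabL κ L)) U n k +
          τ n * inner ℝ (U n (k + 1 + 1) - U n (k + 1)) (stabG κ g (U n (k + 1)) -
          (1 / 2 : ℝ) • Matrix.toEuclideanLin (stabL κ L) (U n (k + 1 + 1) + U n (k + 1))) := by
      rw [dissipation, Finset.sum_Icc_succ_top (by omega),
        hsol.sum_diffEntry_stageDiff hLκ ha hn hτ (by omega) hj, real_inner_smul_right]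
      rfl
    rw [h3, mul_add]
    have h4 : ∀ c : ℝ, -(1 / τ n) * (τ n * c) = -c := fun c => by field_simp
    rw [h4]
    linarith

end EERK

theorem mainTheorem8 :
    (∀ z : ℝ, z < 0 →
      (EERK.symPart (EERK.diffMatrix (EERK.coeff32 (3 / 4) (3 / 5)) 3 z)).PosDef) ∧
    ∀ (M : ℕ) (L : Matrix (Fin M) (Fin M) ℝ)
      (g G : EuclideanSpace ℝ (Fin M) → EuclideanSpace ℝ (Fin M))
      (lip : ℝ≥0) (κ : ℝ) (τ : ℕ → ℝ)
      (u : ℕ → EuclideanSpace ℝ (Fin M)) (U : ℕ → ℕ → EuclideanSpace ℝ (Fin M)),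
      L.PosDef →
      (∀ v, 0 ≤ EERK.potential G v) →
      (∀ v, HasGradientAt (EERK.potential G) (-(g v)) v) →
      0 < lip → LipschitzWith lip g →
      2 * (lip : ℝ) ≤ κ →
      (∀ n, 1 ≤ n → 0 < τ n) →
      EERK.IsSolution 3 (EERK.coeff32 (3 / 4) (3 / 5)) (EERK.stabL κ L) (EERK.stabG κ g) τ u U →
      ∀ n, 1 ≤ n → ∀ j, 1 ≤ j → j ≤ 3 →
        EERK.energy L G (U n (j + 1)) - EERK.energy L G (U n 1) ≤
            -(1 / τ n) * EERK.dissipation (EERK.coeff32 (3 / 4) (3 / 5))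
              (-(τ n • EERK.stabL κ L)) U n j ∧
          -(1 / τ n) * EERK.dissipation (EERK.coeff32 (3 / 4) (3 / 5))
              (-(τ n • EERK.stabL κ L)) U n j ≤ 0 := by
  refine ⟨fun z hz => EERK.symPart_coeff32_posDef hz, ?_⟩
  intro M L g G lip κ τ u U hL _ hG hlip hg hκ hτ hsol n hn j _ hj
  have hlip' : (0 : ℝ) < lip := by exact_mod_cast hlip
  have hLκ : (EERK.stabL κ L).PosDef :=
    hL.add (Matrix.PosDef.one.smul (by linarith))
  have ha : ∀ z < 0, ∀ j ∈ Finset.Icc 1 3, EERK.coeff32 (3 / 4) (3 / 5) (j + 1) j z ≠ 0 := by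
    intro z hz j hj
    obtain ⟨p1, p2, p3⟩ := EERK.coeff32_diag_pos (neg_pos.mpr hz)
    rw [neg_neg] at p1 p2 p3
    obtain ⟨hj1, hj3⟩ := Finset.mem_Icc.mp hj
    interval_cases j
    exacts [p1.ne', p2.ne', p3.ne']
  refine ⟨hsol.energy_sub_le_dissipation hL.isHermitian hLκ hG hg (by linarith) ha hn (hτ n hn) hj,
    ?_⟩
  have h := EERK.dissipation_nonneg (a := EERK.coeff32 (3 / 4) (3 / 5)) (hLκ.smul (hτ n hn))
    U n (j := j) fun z hz v => EERK.coeff32_diffForm_nonneg hz hj v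
  rw [neg_mul, neg_nonpos]
  exact mul_nonneg (one_div_pos.mpr (hτ n hn)).le h

end
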